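/- Let $d\in\mathbb{N}$, $\mathbb{T}^d=(\mathbb{R}/2\pi\mathbb{Z})^d$, and let $H\in C^\infty(\mathbb{R}^d;\mathbb{R})$. For $h>0$ put $S_h^t=e^{-i\frac{t}{h}H(hD_x)}$ on $L^2(\mathbb{T}^d)$, i.e. the Fourier multiplier with symbol $k\mapsto e^{-i\frac{t}{h}H(hk)}$, $k\in\mathbb{Z}^d$. A family $(u_h)_{h>0}$ in $L^2(\mathbb{T}^d)$ is normalised if $\|u_h\|_{L^2}=1$ for all $h$, and $h$-oscillating if $$\limsup_{h\to0^+}\big\|\mathbf 1_{(R,\infty)}(-h^2\Delta)u_h\big\|_{L^2(\mathbb{T}^d)}\longrightarrow0\qquad(R\to\infty).$$ Let $\mathcal{P}(\mathbb{T}^d)$ be the set of Borel probability measures on $\mathbb{T}^d$ with the weak topology, and $L^\infty(\mathbb{R};\mathcal{P}(\mathbb{T}^d))$ the set of measurable families $\nu=(\nu(t,\cdot))_{t\in\mathbb{R}}$ of such measures (up to equality for a.e. $t$), with the weak-$*$ topology, i.e. the one induced by the functionals $\nu\mapsto\int_{\mathbb{R}}\int_{\mathbb{T}^d}f(t,x)\,\nu(t,dx)\,dt$,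 $f\in L^1(\mathbb{R};C(\mathbb{T}^d))$. For $A\subseteq\mathcal{P}(\mathbb{T}^d)$ let $L^\infty(\mathbb{R};A)$ be the set of those $\nu$ with $\nu(t,\cdot)\in A$ for a.e. $t$; a measure in $\mathcal{P}(\mathbb{T}^d)$ is also regarded as a family constant in $t$. A time scale is a function $h\mapsto\tau_h\in(0,\infty)$, $h>0$. - $\mathcal{M}(\tau)\subseteq L^\infty(\mathbb{R};\mathcal{P}(\mathbb{T}^d))$ is the set of weak-$*$ accumulation points, as $h\to0^+$, of $t\mapsto|S_h^{\tau_ht}u_h(x)|^2dx$, where $(u_h)$ ranges over all normalised $h$-oscillating families. - $\mathcal{M}(\infty)\subseteq\mathcal{P}(\mathbb{T}^d)$ is the set of accumulation points, as $h\to0^+$, of $|u_h(x)|^2dx$, where $(u_h)$ ranges over all $h$-oscillating families of normalised eigenfunctions of $H(hD_x)$. - $\mathcal{M}_{\rm av}(\tau)\subseteq\mathcal{P}(\mathbb{T}^d)$ is the set of measures $\int_0^1\nu(t,\cdot)\,dt$, where $\nu$ lies in the weak-$*$ closed convex hull $\overline{\operatorname{Conv}\mathcal{M}(\tau)}$. **Proposition.**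 Let $\tau$ and $\tau'$ be time scales with $\tau_h\to\infty$, $\tau'_h\to\infty$ and $\tau'_h/\tau_h\to0$ as $h\to0^+$. Then $$\mathcal{M}(\infty)\subseteq\mathcal{M}(\tau)\subseteq L^\infty\big(\mathbb{R};\mathcal{M}_{\rm av}(\tau')\big).$$ -/

import Mathlib

open MeasureTheory ProbabilityTheory Filter Topology
open scoped Real ENNReal ContDiff

noncomputable section

namespace TorusSemiclassical

instance factTwoPiPos : Fact ((0 : ℝ) < 2 * π) := ⟨Real.two_pi_pos⟩

/-- The torus `(ℝ / 2πℤ)^d`; `volume` on it is the Lebesgue measure, of total mass `(2π)^d`. -/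
abbrev Torus (d : ℕ) : Type := Fin d → AddCircle (2 * π)

/-- `L²(𝕋^d)`, complex valued. -/
abbrev L2 (d : ℕ) : Type := Lp ℂ 2 (volume : Measure (Torus d))

/-- The integer frequency `k ∈ ℤ^d` as a vector of Euclidean space `ℝ^d`. -/
def freq {d : ℕ} (k : Fin d → ℤ) : EuclideanSpace ℝ (Fin d) :=
  WithLp.toLp 2 (fun i => (k i : ℝ))

/-- The normalised character `x ↦ e^{i k·x} / (2π)^{d/2}`. -/
def character {d : ℕ} (k : Fin d → ℤ) : C(Torus d, ℂ) :=
  ((((2 * π) ^ ((d : ℝ) / 2))⁻¹ : ℝ) : ℂ) •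
    ∏ i, (fourier (k i)).comp ⟨fun x : Torus d => x i, continuous_apply i⟩

/-- The normalised character as an element of `L²(𝕋^d)`. -/
def characterL2 {d : ℕ} (k : Fin d → ℤ) : L2 d :=
  ContinuousMap.toLp 2 volume ℂ (character k)

/-- The Fourier coefficient `û(k) = ∫ u(x) e^{-i k·x} / (2π)^{d/2} dx`. -/
def coeff {d : ℕ} (u : L2 d) (k : Fin d → ℤ) : ℂ :=
  ∫ x, (starRingEnd ℂ) (character k x) * u x

/-- The Fourier multiplier `u ↦ ∑ₖ m(k) û(k) e^{i k·x} / (2π)^{d/2}` on `L²(𝕋^d)`, for a bounded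
symbol `m`; the series converges unconditionally in `L²`. -/
def multiplier {d : ℕ} (m : (Fin d → ℤ) → ℂ) (u : L2 d) : L2 d :=
  ∑' k, (m k * coeff u k) • characterL2 k

/-- The propagator `S_h^t = exp(-i (t/h) H(h D_x))`. -/
def propagator {d : ℕ} (H : EuclideanSpace ℝ (Fin d) → ℝ) (h t : ℝ) (u : L2 d) : L2 d :=
  multiplier (fun k => Complex.exp (-Complex.I * ((t / h * H (h • freq k) : ℝ) : ℂ))) u

/-- The spectral projection `𝟏_{(R, ∞)}(-h² Δ)`. -/
def highFreqProj {d : ℕ} (h R : ℝ) (u : L2 d) : L2 d :=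
  multiplier (fun k => Set.indicator (Set.Ioi R) (fun _ => (1 : ℂ)) (h ^ 2 * ‖freq k‖ ^ 2)) u

/-- A family `(u_h)` is `h`-oscillating:
`limsup_{h → 0⁺} ‖𝟏_{(R, ∞)}(-h² Δ) u_h‖ → 0` as `R → ∞`. -/
def IsOscillating {d : ℕ} (u : ℝ → L2 d) : Prop :=
  Tendsto (fun R : ℝ => limsup (fun h : ℝ => ‖highFreqProj h R (u h)‖) (𝓝[>] 0)) atTop (𝓝 0)

/-- `u` solves `H(h D_x) u = E u` for some real `E`, i.e. `û(k) = 0` unless `H(h k) = E`. -/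
def IsEigenfunction {d : ℕ} (H : EuclideanSpace ℝ (Fin d) → ℝ) (h : ℝ) (u : L2 d) : Prop :=
  ∃ E : ℝ, ∀ k, ((H (h • freq k) : ℝ) : ℂ) * coeff u k = (E : ℂ) * coeff u k

/-- The position density `|u(x)|² dx`. -/
def density {d : ℕ} (u : L2 d) : Measure (Torus d) :=
  volume.withDensity (fun x => ‖u x‖ₑ ^ 2)

theorem isProbabilityMeasure_density {d : ℕ} {u : L2 d} (hu : ‖u‖ = 1) :
    IsProbabilityMeasure (density u) := by
  constructor
  have h1 : eLpNorm u 2 volume = 1 := by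
    have := Lp.enorm_def u
    rw [← this, ← ofReal_norm, hu, ENNReal.ofReal_one]
  have h2 : (∫⁻ x, ‖u x‖ₑ ^ 2) = 1 := by
    have h3 := eLpNorm_nnreal_pow_eq_lintegral (f := (u : Torus d → ℂ)) (μ := volume)
      (p := 2) two_ne_zero
    simp only [ENNReal.coe_ofNat, NNReal.coe_ofNat, ENNReal.rpow_ofNat, h1, one_pow] at h3
    exact h3.symm
  rw [density, withDensity_apply _ MeasurableSet.univ, Measure.restrict_univ, h2]

/-- `L^∞(ℝ; 𝒫(𝕋^d))`: measurable families of probability measures on `𝕋^d` indexed by time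
(representatives; all notions below are invariant under modification on a null set of times). -/
abbrev LinfProb (d : ℕ) : Type := {ν : Kernel ℝ (Torus d) // IsMarkovKernel ν}

/-- The value at time `t`. -/
def LinfProb.at {d : ℕ} (ν : LinfProb d) (t : ℝ) : ProbabilityMeasure (Torus d) :=
  ⟨ν.1 t, ν.2.isProbabilityMeasure t⟩

/-- A probability measure, seen as a family that does not depend on time. -/
def constFamily {d : ℕ} (ρ : ProbabilityMeasure (Torus d)) : LinfProb d :=
  ⟨Kernel.const ℝ (ρ : Measure (Torus d)), inferInstance⟩

/-- The predual `L¹(ℝ; C(𝕋^d))`. -/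
abbrev Predual (d : ℕ) : Type := Lp (C(Torus d, ℝ)) 1 (volume : Measure ℝ)

/-- The functional `f ↦ ∫ ∫ f(t, x) ν(t, dx) dt` on `L¹(ℝ; C(𝕋^d))`. The weak-* topology is the
topology of pointwise convergence of these functionals. -/
def pairing {d : ℕ} (ν : ℝ → Measure (Torus d)) : Predual d → ℝ :=
  fun f => ∫ t : ℝ, ∫ x, (f t) x ∂(ν t)

/-- Weak-* closed convex hull in `L^∞(ℝ; 𝒫(𝕋^d))`. -/
def closedConv {d : ℕ} (X : Set (LinfProb d)) : Set (LinfProb d) :=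
  {ν | pairing ν.1 ∈ closedConvexHull ℝ ((fun ν' : LinfProb d => pairing ν'.1) '' X)}

/-- `ℳ(τ)`: weak-* accumulation points as `h → 0⁺` of `t ↦ |S_h^{τ_h t} u_h|² dx`, where `(u_h)`
ranges over all normalised `h`-oscillating families. -/
def limitSet {d : ℕ} (H : EuclideanSpace ℝ (Fin d) → ℝ) (τ : ℝ → ℝ) : Set (LinfProb d) :=
  {ν | ∃ u : ℝ → L2 d, (∀ h, ‖u h‖ = 1) ∧ IsOscillating u ∧
    MapClusterPt (pairing ν.1) (𝓝[>] (0 : ℝ))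
      (fun h => pairing (fun t => density (propagator H h (τ h * t) (u h))))}

/-- `ℳ(∞)`: accumulation points in `𝒫(𝕋^d)` as `h → 0⁺` of `|u_h|² dx`, where `(u_h)` ranges over
all `h`-oscillating families of normalised eigenfunctions of `H(h D_x)`. -/
def eigenLimitSet {d : ℕ} (H : EuclideanSpace ℝ (Fin d) → ℝ) :
    Set (ProbabilityMeasure (Torus d)) :=
  {ρ | ∃ (u : ℝ → L2 d) (hu : ∀ h, ‖u h‖ = 1),
    (∀ h, 0 < h → IsEigenfunction H h (u h)) ∧ IsOscillating u ∧
    MapClusterPt ρ (𝓝[>] (0 : ℝ))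
      (fun h => (⟨density (u h), isProbabilityMeasure_density (hu h)⟩ :
        ProbabilityMeasure (Torus d)))}

/-- `ℳ_av(τ)`: the measures `∫₀¹ ν(t, ·) dt` with `ν` in the closed convex hull of `ℳ(τ)`. -/
def averageSet {d : ℕ} (H : EuclideanSpace ℝ (Fin d) → ℝ) (τ : ℝ → ℝ) :
    Set (ProbabilityMeasure (Torus d)) :=
  {ρ | ∃ ν ∈ closedConv (limitSet H τ),
    (ρ : Measure (Torus d)) = (volume.restrict (Set.Icc (0 : ℝ) 1)).bind ν.1}

/-- `L^∞(ℝ; A)` for a set `A` of probability measures. -/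
def LinfIn {d : ℕ} (A : Set (ProbabilityMeasure (Torus d))) : Set (LinfProb d) :=
  {ν | ∀ᵐ t : ℝ, ν.at t ∈ A}

/-- A time scale `h ↦ τ_h > 0` (defined for `h > 0`) that tends to infinity as `h → 0⁺`. -/
def IsTimeScaleToInfty (τ : ℝ → ℝ) : Prop :=
  (∀ h, 0 < h → 0 < τ h) ∧ Tendsto τ (𝓝[>] 0) atTop

end TorusSemiclassical

end

/-!
Eigenfunctions of `H(h D_x)` evolve by a phase, so their position densities do not depend on time;
since `ρ ↦ (f ↦ ∫∫ f(t, x) ρ(dx) dt)` is continuous on `𝒫(𝕋^d)`, accumulation points in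
`𝒫(𝕋^d)` become, as constant families, weak-* accumulation points at any time scale. This is
`constFamily_mem_limitSet`; the Hilbert basis of characters makes the Fourier multipliers explicit.

For the second inclusion, let `ν ∈ ℳ(τ)` come from `(u_h)`. A time interval of length
`ε_h = τ'_h / τ_h` at scale `τ` is a unit interval at scale `τ'`. Since `ε_h → 0`, the mean over
`(a, b]` of `t ↦ ∫ φ |S_h^{τ_h t} u_h|²` is, up to `o(1)`, a mean of averages over such short
windows, hence at most the average over one of them, starting at some `s_h`. By the group law that
average is a
unit-window average at scale `τ'` for the initial data `S_h^{τ_h s_h} u_h`, which are again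
normalised and `h`-oscillating. In the limit
`∫_a^b ∫ φ dν(t) dt ≤ (b - a) ∫_0^1 ∫ φ dν'(r) dr` for some `ν' ∈ ℳ(τ')`
(`exists_integral_le_of_mem_limitSet`), and Lebesgue differentiation turns this into a bound of
`∫ φ dν(t)`, for almost every `t`, by the support function of the averages over `ℳ(τ')`.
The Hahn–Banach theorem in `ℝ^{C(𝕋^d)}` then places `ν(t)` among the unit-window averages of the
closed convex hull (`exists_mem_closedConv_windowAverage_eq`).

Both the existence of `ν'` and the closedness needed for separation rest on the weak-* compactness
of `L^∞(ℝ; 𝒫(𝕋^d))`: the functionals `pairing ν` are exactly the positive normalised ones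
(`IsProbFunctional`), a closed subset of a product of compact intervals. That each such functional
is represented by a measurable family (`IsProbFunctional.exists_pairing_eq`) follows by
disintegrating over time the measure that the Riesz–Markov–Kakutani theorem gives on `ℝ × 𝕋^d`.
-/

noncomputable section

namespace TorusSemiclassical

open scoped CompactlySupported

/-! ### Fourier series on the torus -/

lemma character_apply {d : ℕ} (k : Fin d → ℤ) (x : Torus d) :
    character k x = ((((2 * π) ^ ((d : ℝ) / 2))⁻¹ : ℝ) : ℂ) * ∏ i, fourier (k i) (x i) := by
  simp [character]

/-- The unnormalised character `x ↦ e^{i k·x}`. -/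
def monomial {d : ℕ} (k : Fin d → ℤ) : C(Torus d, ℂ) :=
  ⟨fun x => ∏ i, fourier (k i) (x i), by fun_prop⟩

lemma character_eq_smul_monomial {d : ℕ} (k : Fin d → ℤ) :
    character k = ((((2 * π) ^ ((d : ℝ) / 2))⁻¹ : ℝ) : ℂ) • monomial k := by
  ext x
  simp [character_apply, monomial]

/-- The star subalgebra of `C(𝕋^d, ℂ)` generated by the monomials. -/
def monomialSubalgebra (d : ℕ) : StarSubalgebra ℂ C(Torus d, ℂ) where
  toSubalgebra := Algebra.adjoin ℂ (Set.range monomial)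
  star_mem' := by
    change Algebra.adjoin ℂ (Set.range monomial) ≤ star (Algebra.adjoin ℂ (Set.range monomial))
    refine Algebra.adjoin_le ?_
    rintro _ ⟨n, rfl⟩
    refine Algebra.subset_adjoin ⟨-n, ?_⟩
    ext1 x
    simp [monomial, ContinuousMap.star_apply]

lemma monomialSubalgebra_coe (d : ℕ) :
    Subalgebra.toSubmodule (monomialSubalgebra d).toSubalgebra =
      Submodule.span ℂ (Set.range (monomial (d := d))) := by
  apply Algebra.adjoin_eq_span_of_subset
  refine .trans (fun x ↦ Submonoid.closure_induction (fun _ ↦ id) ⟨0, ?_⟩ ?_) Submodule.subset_span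
  · ext z
    simp [monomial]
  · rintro _ _ _ _ ⟨m, rfl⟩ ⟨n, rfl⟩
    refine ⟨m + n, ?_⟩
    ext z
    simp [monomial, Finset.prod_mul_distrib]

lemma monomialSubalgebra_separatesPoints (d : ℕ) :
    (monomialSubalgebra d).toSubalgebra.SeparatesPoints := by
  intro x y hxy
  obtain ⟨i, hi⟩ := Function.ne_iff.mp hxy
  have key : ∀ z : Torus d, monomial (Pi.single i 1) z = fourier 1 (z i) := by
    intro z
    simp only [monomial, ContinuousMap.coe_mk]
    rw [Finset.prod_eq_single i]
    · simp
    · intro j _ hj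
      rw [Pi.single_eq_of_ne hj, fourier_zero]
    · simp
  refine ⟨_, ⟨monomial (Pi.single i 1), Algebra.subset_adjoin ⟨Pi.single i 1, rfl⟩, rfl⟩, ?_⟩
  change monomial (Pi.single i 1) x ≠ monomial (Pi.single i 1) y
  rw [key, key, fourier_one, fourier_one]
  contrapose hi
  exact AddCircle.injective_toCircle Real.two_pi_pos.ne' (Circle.ext hi)

lemma span_monomial_closure_eq_top (d : ℕ) :
    (Submodule.span ℂ (Set.range (monomial (d := d)))).topologicalClosure = ⊤ := by
  rw [← monomialSubalgebra_coe]
  exact congr_arg (Subalgebra.toSubmodule <| StarSubalgebra.toSubalgebra ·)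
    (ContinuousMap.starSubalgebra_topologicalClosure_eq_top_of_separatesPoints _
      (monomialSubalgebra_separatesPoints d))

lemma span_character_closure_eq_top (d : ℕ) :
    (Submodule.span ℂ (Set.range (character (d := d)))).topologicalClosure = ⊤ := by
  have hc : ((((2 * π) ^ ((d : ℝ) / 2))⁻¹ : ℝ) : ℂ) ≠ 0 := by
    have : (0 : ℝ) < ((2 * π) ^ ((d : ℝ) / 2))⁻¹ := by positivity
    exact_mod_cast this.ne'
  refine top_unique ?_
  rw [← span_monomial_closure_eq_top d]
  refine Submodule.topologicalClosure_mono (Submodule.span_le.2 ?_)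
  rintro _ ⟨k, rfl⟩
  have : monomial k = ((((2 * π) ^ ((d : ℝ) / 2))⁻¹ : ℝ) : ℂ)⁻¹ • character k := by
    rw [character_eq_smul_monomial, smul_smul, inv_mul_cancel₀ hc, one_smul]
  rw [this]
  exact Submodule.smul_mem _ _ (Submodule.subset_span ⟨k, rfl⟩)

lemma span_characterL2_closure_eq_top (d : ℕ) :
    (Submodule.span ℂ (Set.range (characterL2 (d := d)))).topologicalClosure = ⊤ := by
  have := (ContinuousMap.toLp_denseRange ℂ (volume : Measure (Torus d)) ℂ
    (p := 2) (by simp)).topologicalClosure_map_submodule (span_character_closure_eq_top d)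
  rw [Submodule.map_span, ← Set.range_comp] at this
  exact this

lemma integral_conj_fourier_mul_fourier (m n : ℤ) :
    ∫ x : AddCircle (2 * π), (starRingEnd ℂ) (fourier m x) * fourier n x =
      if m = n then ((2 * π : ℝ) : ℂ) else 0 := by
  have h := orthonormal_iff_ite.mp (orthonormal_fourier (T := 2 * π)) m n
  rw [ContinuousMap.inner_toLp] at h
  rw [AddCircle.volume_eq_smul_haarAddCircle, integral_smul_measure,
    ENNReal.toReal_ofReal Real.two_pi_pos.le]
  have h' : ∫ x : AddCircle (2 * π), (starRingEnd ℂ) (fourier m x) * fourier n x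
      ∂AddCircle.haarAddCircle = if m = n then 1 else 0 := by
    rw [← h]
    congr 1
    ext x
    ring
  rw [h']
  split_ifs <;> simp

lemma orthonormal_characterL2 (d : ℕ) : Orthonormal ℂ (characterL2 (d := d)) := by
  rw [orthonormal_iff_ite]
  intro k l
  rw [characterL2, characterL2, ContinuousMap.inner_toLp]
  have h1 : ∀ x : Torus d, character l x * (starRingEnd ℂ) (character k x) =
      (((2 * π) ^ (d : ℝ))⁻¹ : ℝ) *
        ∏ i, ((starRingEnd ℂ) (fourier (k i) (x i)) * fourier (l i) (x i)) := by
    intro x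
    have hc : (2 * π) ^ (d : ℝ) = (2 * π) ^ ((d : ℝ) / 2) * (2 * π) ^ ((d : ℝ) / 2) := by
      rw [← Real.rpow_add Real.two_pi_pos, add_halves]
    rw [character_apply, character_apply, map_mul, Complex.conj_ofReal, map_prod,
      Finset.prod_mul_distrib, hc, mul_inv]
    push_cast
    ring
  simp_rw [h1]
  rw [integral_const_mul, integral_fintype_prod_volume_eq_prod (𝕜 := ℂ)
    (f := fun i (y : AddCircle (2 * π)) => (starRingEnd ℂ) (fourier (k i) y) * fourier (l i) y)]
  simp_rw [integral_conj_fourier_mul_fourier]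
  split_ifs with h
  · subst h
    simp only [if_true, Finset.prod_const, Finset.card_univ, Fintype.card_fin]
    rw [Real.rpow_natCast]
    have : ((2 * π : ℝ) : ℂ) ^ d ≠ 0 :=
      pow_ne_zero _ (by exact_mod_cast Real.two_pi_pos.ne')
    rw [Complex.ofReal_inv, Complex.ofReal_pow, inv_mul_cancel₀ this]
  · obtain ⟨i, hi⟩ := Function.ne_iff.mp h
    rw [Finset.prod_eq_zero (Finset.mem_univ i) (if_neg hi), mul_zero]

/-- The characters as a Hilbert basis of `L²(𝕋^d)`. -/
def fourierBasis (d : ℕ) : HilbertBasis (Fin d → ℤ) ℂ (L2 d) :=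
  HilbertBasis.mk (orthonormal_characterL2 d) (span_characterL2_closure_eq_top d).ge

lemma fourierBasis_apply {d : ℕ} (k : Fin d → ℤ) : fourierBasis d k = characterL2 k := by
  rw [fourierBasis, HilbertBasis.coe_mk]

lemma fourierBasis_repr {d : ℕ} (u : L2 d) (k : Fin d → ℤ) :
    (fourierBasis d).repr u k = coeff u k := by
  rw [HilbertBasis.repr_apply_apply, fourierBasis_apply, L2.inner_def, coeff]
  refine integral_congr_ae ?_
  filter_upwards [ContinuousMap.coeFn_toLp (p := 2) (𝕜 := ℂ) volume (character k)] with x hx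
  rw [RCLike.inner_apply, characterL2, hx, mul_comm]

lemma ext_coeff {d : ℕ} {u v : L2 d} (h : ∀ k, coeff u k = coeff v k) : u = v := by
  apply (fourierBasis d).repr.injective
  ext k
  rw [fourierBasis_repr, fourierBasis_repr, h]

lemma coeff_smul {d : ℕ} (c : ℂ) (u : L2 d) (k : Fin d → ℤ) :
    coeff (c • u) k = c * coeff u k := by
  simp [← fourierBasis_repr]

lemma hasSum_norm_coeff_sq {d : ℕ} (u : L2 d) :
    HasSum (fun k => ‖coeff u k‖ ^ 2) (‖u‖ ^ 2) := by
  have h := lp.hasSum_norm (p := 2) (by simp) ((fourierBasis d).repr u)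
  rw [LinearIsometryEquiv.norm_map] at h
  simpa [fourierBasis_repr] using h

/-! ### Fourier multipliers with bounded symbol -/

lemma memlp_mul_coeff {d : ℕ} {m : (Fin d → ℤ) → ℂ} (hm : ∀ k, ‖m k‖ ≤ 1) (u : L2 d) :
    Memℓp (fun k => m k * coeff u k) 2 := by
  have h : Memℓp (fun k => coeff u k) 2 := by
    have := lp.memℓp ((fourierBasis d).repr u)
    rwa [show ((fourierBasis d).repr u : (Fin d → ℤ) → ℂ) = fun k => coeff u k from
      funext (fourierBasis_repr u)] at this
  refine h.mono' fun k => ?_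
  rw [norm_mul]
  exact mul_le_of_le_one_left (norm_nonneg _) (hm k)

lemma hasSum_multiplier {d : ℕ} {m : (Fin d → ℤ) → ℂ} (hm : ∀ k, ‖m k‖ ≤ 1) (u : L2 d) :
    HasSum (fun k => (m k * coeff u k) • characterL2 k) (multiplier m u) := by
  have h := (fourierBasis d).hasSum_repr_symm ⟨_, memlp_mul_coeff hm u⟩
  simp only [fourierBasis_apply] at h
  exact h.summable.hasSum

lemma coeff_multiplier {d : ℕ} {m : (Fin d → ℤ) → ℂ} (hm : ∀ k, ‖m k‖ ≤ 1) (u : L2 d)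
    (k : Fin d → ℤ) : coeff (multiplier m u) k = m k * coeff u k := by
  have h := (fourierBasis d).hasSum_repr_symm ⟨_, memlp_mul_coeff hm u⟩
  simp only [fourierBasis_apply] at h
  rw [(hasSum_multiplier hm u).unique h, ← fourierBasis_repr, LinearIsometryEquiv.apply_symm_apply]

lemma norm_eq_of_norm_coeff_eq {d : ℕ} {u v : L2 d} (h : ∀ k, ‖coeff u k‖ = ‖coeff v k‖) :
    ‖u‖ = ‖v‖ := by
  have h1 := hasSum_norm_coeff_sq u
  simp_rw [h] at h1
  have h2 := h1.unique (hasSum_norm_coeff_sq v)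
  exact (sq_eq_sq₀ (norm_nonneg _) (norm_nonneg _)).1 h2

/-! ### The propagator -/

lemma norm_propagator_symbol {d : ℕ} (H : EuclideanSpace ℝ (Fin d) → ℝ) (h t : ℝ)
    (k : Fin d → ℤ) :
    ‖Complex.exp (-Complex.I * ((t / h * H (h • freq k) : ℝ) : ℂ))‖ = 1 := by
  rw [neg_mul, mul_comm, ← neg_mul, ← Complex.ofReal_neg, Complex.norm_exp_ofReal_mul_I]

lemma coeff_propagator {d : ℕ} (H : EuclideanSpace ℝ (Fin d) → ℝ) (h t : ℝ) (u : L2 d)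
    (k : Fin d → ℤ) : coeff (propagator H h t u) k =
      Complex.exp (-Complex.I * ((t / h * H (h • freq k) : ℝ) : ℂ)) * coeff u k :=
  coeff_multiplier (fun k => (norm_propagator_symbol H h t k).le) u k

lemma norm_coeff_propagator {d : ℕ} (H : EuclideanSpace ℝ (Fin d) → ℝ) (h t : ℝ) (u : L2 d)
    (k : Fin d → ℤ) : ‖coeff (propagator H h t u) k‖ = ‖coeff u k‖ := by
  rw [coeff_propagator, norm_mul, norm_propagator_symbol, one_mul]

lemma norm_propagator {d : ℕ} (H : EuclideanSpace ℝ (Fin d) → ℝ) (h t : ℝ) (u : L2 d) :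
    ‖propagator H h t u‖ = ‖u‖ :=
  norm_eq_of_norm_coeff_eq (norm_coeff_propagator H h t u)

/-- The group law `S_h^s S_h^t = S_h^{s + t}`. -/
lemma propagator_propagator {d : ℕ} (H : EuclideanSpace ℝ (Fin d) → ℝ) (h s t : ℝ) (u : L2 d) :
    propagator H h s (propagator H h t u) = propagator H h (s + t) u := by
  refine ext_coeff fun k => ?_
  rw [coeff_propagator, coeff_propagator, coeff_propagator, ← mul_assoc, ← Complex.exp_add]
  congr 2
  push_cast
  ring

lemma norm_highFreqProj_propagator {d : ℕ} (H : EuclideanSpace ℝ (Fin d) → ℝ) (h t R : ℝ)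
    (u : L2 d) : ‖highFreqProj h R (propagator H h t u)‖ = ‖highFreqProj h R u‖ := by
  refine norm_eq_of_norm_coeff_eq fun k => ?_
  have hm : ∀ k : Fin d → ℤ,
      ‖Set.indicator (Set.Ioi R) (fun _ => (1 : ℂ)) (h ^ 2 * ‖freq k‖ ^ 2)‖ ≤ 1 := fun k => by
    by_cases hk : h ^ 2 * ‖freq k‖ ^ 2 ∈ Set.Ioi R
    · simp [Set.indicator_of_mem hk]
    · simp [Set.indicator_of_notMem hk]
  rw [highFreqProj, highFreqProj, coeff_multiplier hm, coeff_multiplier hm, norm_mul, norm_mul,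
    norm_coeff_propagator]

lemma IsOscillating.propagator {d : ℕ} {u : ℝ → L2 d} (hu : IsOscillating u)
    (H : EuclideanSpace ℝ (Fin d) → ℝ) (t : ℝ → ℝ) :
    IsOscillating fun h => propagator H h (t h) (u h) := by
  simpa only [IsOscillating, norm_highFreqProj_propagator] using hu

/-- An eigenfunction only picks up a phase along the flow. -/
lemma IsEigenfunction.propagator_eq {d : ℕ} {H : EuclideanSpace ℝ (Fin d) → ℝ} {h : ℝ} {u : L2 d}
    (hu : IsEigenfunction H h u) :
    ∃ E : ℝ, ∀ t, propagator H h t u = Complex.exp (((-(t / h * E) : ℝ) : ℂ) * Complex.I) • u := by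
  obtain ⟨E, hE⟩ := hu
  refine ⟨E, fun t => ext_coeff fun k => ?_⟩
  rw [coeff_propagator, coeff_smul]
  by_cases hk : coeff u k = 0
  · simp [hk]
  · have : H (h • freq k) = E := by exact_mod_cast mul_right_cancel₀ hk (hE k)
    rw [this]
    congr 2
    push_cast
    ring

lemma stronglyMeasurable_propagator {d : ℕ} (H : EuclideanSpace ℝ (Fin d) → ℝ) (h : ℝ)
    (u : L2 d) : StronglyMeasurable fun t => propagator H h t u := by
  refine stronglyMeasurable_of_tendsto (atTop : Filter (Finset (Fin d → ℤ)))
    (f := fun s t => ∑ k ∈ s,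
      (Complex.exp (-Complex.I * ((t / h * H (h • freq k) : ℝ) : ℂ)) * coeff u k) • characterL2 k)
    (fun s => ?_) (tendsto_pi_nhds.2 fun t => ?_)
  · have : Continuous fun t : ℝ => ∑ k ∈ s,
      (Complex.exp (-Complex.I * ((t / h * H (h • freq k) : ℝ) : ℂ)) * coeff u k) •
        characterL2 k := by fun_prop
    exact this.stronglyMeasurable
  · exact hasSum_multiplier (fun k => (norm_propagator_symbol H h t k).le) u

/-! ### Position densities -/

lemma density_smul {d : ℕ} {c : ℂ} (hc : ‖c‖ = 1) (u : L2 d) : density (c • u) = density u := by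
  refine withDensity_congr_ae ?_
  filter_upwards [Lp.coeFn_smul c u] with x hx
  have : ‖c‖ₑ = 1 := by rw [← ofReal_norm, hc, ENNReal.ofReal_one]
  rw [hx, Pi.smul_apply, enorm_smul, this, one_mul]

lemma density_apply {d : ℕ} (u : L2 d) {s : Set (Torus d)} (hs : MeasurableSet s) :
    density u s = ‖LpToLpRestrictCLM (Torus d) ℂ ℂ volume 2 s u‖ₑ ^ 2 := by
  rw [density, withDensity_apply _ hs, Lp.enorm_def,
    eLpNorm_congr_ae (LpToLpRestrictCLM_coeFn ℂ s u)]
  have h3 := eLpNorm_nnreal_pow_eq_lintegral (f := (u : Torus d → ℂ)) (μ := volume.restrict s)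
    (p := 2) two_ne_zero
  simp only [ENNReal.coe_ofNat, NNReal.coe_ofNat, ENNReal.rpow_ofNat] at h3
  exact h3.symm

/-- The evolved position densities `t ↦ |S_h^{a t} u|² dx` of a normalised `u`, as an element of
`L^∞(ℝ; 𝒫(𝕋^d))`. -/
def evolvedDensity {d : ℕ} (H : EuclideanSpace ℝ (Fin d) → ℝ) (h a : ℝ) {u : L2 d}
    (hu : ‖u‖ = 1) : LinfProb d :=
  ⟨⟨fun t => density (propagator H h (a * t) u), by
      refine Measure.measurable_of_measurable_coe _ fun s hs => ?_
      simp_rw [density_apply _ hs]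
      have h1 : StronglyMeasurable fun t => LpToLpRestrictCLM (Torus d) ℂ ℂ volume 2 s
          (propagator H h (a * t) u) :=
        (LpToLpRestrictCLM (Torus d) ℂ ℂ volume 2 s).continuous.comp_stronglyMeasurable
          ((stronglyMeasurable_propagator H h u).comp_measurable (measurable_const_mul a))
      exact h1.enorm.pow_const 2⟩,
    ⟨fun t => isProbabilityMeasure_density (by rw [norm_propagator, hu])⟩⟩

/-! ### The duality between `L¹(ℝ; C(𝕋^d))` and families of probability measures -/

lemma integrable_continuousMap {d : ℕ} (φ : C(Torus d, ℝ)) (μ : Measure (Torus d))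
    [IsFiniteMeasure μ] : Integrable φ μ :=
  φ.continuous.integrable_of_hasCompactSupport (HasCompactSupport.of_compactSpace _)

lemma abs_integral_le_norm {d : ℕ} (φ : C(Torus d, ℝ)) (μ : Measure (Torus d))
    [IsProbabilityMeasure μ] : |∫ x, φ x ∂μ| ≤ ‖φ‖ := by
  have h := norm_integral_le_of_norm_le_const (μ := μ) (ae_of_all _ φ.norm_coe_le_norm)
  simpa using h

lemma stronglyMeasurable_integral_kernel {d : ℕ} (ν : Kernel ℝ (Torus d)) [IsMarkovKernel ν]
    {f : ℝ → C(Torus d, ℝ)} (hf : StronglyMeasurable f) :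
    StronglyMeasurable fun t => ∫ x, f t x ∂ν t := by
  have h1 : StronglyMeasurable fun p : ℝ × Torus d => f p.1 p.2 := by
    have h2 : Continuous fun q : C(Torus d, ℝ) × Torus d => q.1 q.2 := by fun_prop
    exact h2.comp_stronglyMeasurable
      ((hf.comp_measurable measurable_fst).prodMk measurable_snd.stronglyMeasurable)
  exact h1.integral_kernel_prod_right'

instance isMarkovKernel_coe {d : ℕ} (ν : LinfProb d) : IsMarkovKernel ν.1 := ν.2

lemma integrable_integral_kernel {d : ℕ} (ν : LinfProb d) {f : ℝ → C(Torus d, ℝ)}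
    (hf : Integrable f) : Integrable fun t => ∫ x, f t x ∂ν.1 t := by
  refine hf.norm.mono' ?_ (ae_of_all _ fun t => abs_integral_le_norm _ _)
  refine ⟨_, stronglyMeasurable_integral_kernel ν.1 hf.1.stronglyMeasurable_mk, ?_⟩
  filter_upwards [hf.1.ae_eq_mk] with t ht
  rw [← ht]

lemma pairing_toL1 {d : ℕ} (ν : ℝ → Measure (Torus d)) {f : ℝ → C(Torus d, ℝ)}
    (hf : Integrable f) : pairing ν (hf.toL1 f) = ∫ t, ∫ x, f t x ∂ν t := by
  refine integral_congr_ae ?_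
  filter_upwards [hf.coeFn_toL1] with t ht
  rw [ht]

/-- The functionals on `L¹(ℝ; C(𝕋^d))` that come from elements of `L^∞(ℝ; 𝒫(𝕋^d))`
(see `exists_pairing_eq`): linear, positive, of norm at most one, and given by the Lebesgue
integral on functions of time alone. All these conditions are closed and convex. -/
structure IsProbFunctional {d : ℕ} (L : Predual d → ℝ) : Prop where
  map_add : ∀ f g, L (f + g) = L f + L g
  map_smul : ∀ (c : ℝ) f, L (c • f) = c * L f
  abs_apply_le : ∀ f, |L f| ≤ ‖f‖
  nonneg : ∀ f, (∀ᵐ t, 0 ≤ f t) → 0 ≤ L f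
  map_time : ∀ (θ : ℝ → ℝ) (hθ : Integrable θ),
    L ((hθ.smul_const (1 : C(Torus d, ℝ))).toL1 _) = ∫ t, θ t

lemma isProbFunctional_pairing {d : ℕ} (ν : LinfProb d) : IsProbFunctional (pairing ν.1) where
  map_add f g := by
    rw [pairing, pairing, pairing, ← integral_add
      (integrable_integral_kernel ν (L1.integrable_coeFn f))
      (integrable_integral_kernel ν (L1.integrable_coeFn g))]
    refine integral_congr_ae ?_
    filter_upwards [Lp.coeFn_add f g] with t ht
    rw [ht, ← integral_add (integrable_continuousMap _ _) (integrable_continuousMap _ _)]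
    rfl
  map_smul c f := by
    rw [pairing, pairing, ← integral_const_mul]
    refine integral_congr_ae ?_
    filter_upwards [Lp.coeFn_smul c f] with t ht
    rw [ht, ← integral_const_mul]
    rfl
  abs_apply_le f := by
    rw [L1.norm_eq_integral_norm]
    exact norm_integral_le_of_norm_le (f := fun t => ∫ x, f t x ∂ν.1 t)
      (L1.integrable_coeFn f).norm (ae_of_all _ fun t => abs_integral_le_norm _ _)
  nonneg f hf := by
    refine integral_nonneg_of_ae ?_
    filter_upwards [hf] with t ht
    exact integral_nonneg fun x => ht x
  map_time θ hθ := by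
    rw [pairing_toL1]
    simp

lemma isClosed_setOf_isProbFunctional (d : ℕ) :
    IsClosed {L : Predual d → ℝ | IsProbFunctional L} := by
  have h : {L : Predual d → ℝ | IsProbFunctional L} =
      {L | ∀ f g, L (f + g) = L f + L g} ∩ {L | ∀ (c : ℝ) f, L (c • f) = c * L f} ∩
      {L | ∀ f, |L f| ≤ ‖f‖} ∩ {L | ∀ f : Predual d, (∀ᵐ t, 0 ≤ f t) → 0 ≤ L f} ∩
      {L | ∀ (θ : ℝ → ℝ) (hθ : Integrable θ),
        L ((hθ.smul_const (1 : C(Torus d, ℝ))).toL1 _) = ∫ t, θ t} := by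
    ext L
    exact ⟨fun h => ⟨⟨⟨⟨h.1, h.2⟩, h.3⟩, h.4⟩, h.5⟩,
      fun h => ⟨h.1.1.1.1, h.1.1.1.2, h.1.1.2, h.1.2, h.2⟩⟩
  rw [h]
  simp only [Set.ofPred_forall]
  refine IsClosed.inter (IsClosed.inter (IsClosed.inter (IsClosed.inter ?_ ?_) ?_) ?_) ?_
  · exact isClosed_iInter fun f => isClosed_iInter fun g =>
      isClosed_eq (continuous_apply _) ((continuous_apply f).fun_add (continuous_apply g))
  · exact isClosed_iInter fun c => isClosed_iInter fun g =>
      isClosed_eq (continuous_apply _) (continuous_const.fun_mul (continuous_apply g))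
  · exact isClosed_iInter fun f => isClosed_le (continuous_apply _).abs continuous_const
  · exact isClosed_iInter fun f => isClosed_iInter fun _ =>
      isClosed_le continuous_const (continuous_apply _)
  · exact isClosed_iInter fun θ => isClosed_iInter fun _ =>
      isClosed_eq (continuous_apply _) continuous_const

lemma isCompact_setOf_isProbFunctional (d : ℕ) :
    IsCompact {L : Predual d → ℝ | IsProbFunctional L} := by
  refine (isCompact_univ_pi (s := fun f : Predual d => Set.Icc (-‖f‖) ‖f‖)
    fun f => isCompact_Icc).of_isClosed_subset (isClosed_setOf_isProbFunctional d) ?_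
  exact fun L hL f _ => abs_le.1 (hL.abs_apply_le f)

lemma convex_setOf_isProbFunctional (d : ℕ) :
    Convex ℝ {L : Predual d → ℝ | IsProbFunctional L} := by
  intro L hL M hM a b ha hb hab
  refine ⟨fun f g => ?_, fun c f => ?_, fun f => ?_, fun f hf => ?_, fun θ hθ => ?_⟩
  · simp only [Pi.add_apply, Pi.smul_apply, smul_eq_mul, hL.map_add, hM.map_add]
    ring
  · simp only [Pi.add_apply, Pi.smul_apply, smul_eq_mul, hL.map_smul, hM.map_smul]
    ring
  · have h1 := abs_le.1 (hL.abs_apply_le f)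
    have h2 := abs_le.1 (hM.abs_apply_le f)
    simpa [abs_le] using (convex_Icc (-‖f‖) ‖f‖) h1 h2 ha hb hab
  · have h1 := hL.nonneg f hf
    have h2 := hM.nonneg f hf
    simp only [Pi.add_apply, Pi.smul_apply, smul_eq_mul]
    positivity
  · rw [Pi.add_apply, Pi.smul_apply, Pi.smul_apply, hL.map_time θ hθ, hM.map_time θ hθ,
      ← add_smul, hab, one_smul]

/-! ### Representation of positive functionals by families of probability measures -/

lemma continuous_gaussianPDFReal_zero_one : Continuous (gaussianPDFReal 0 1) := by
  unfold gaussianPDFReal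
  fun_prop

/-- The function `t ↦ w(t) g(t, ·)` for a compactly supported continuous `g` on `ℝ × 𝕋^d`, where
`w` is the standard Gaussian density. -/
def weightedSlice {d : ℕ} (g : C_c(ℝ × Torus d, ℝ)) (t : ℝ) : C(Torus d, ℝ) :=
  gaussianPDFReal 0 1 t • g.toContinuousMap.curry t

lemma weightedSlice_apply {d : ℕ} (g : C_c(ℝ × Torus d, ℝ)) (t : ℝ) (x : Torus d) :
    weightedSlice g t x = gaussianPDFReal 0 1 t * g (t, x) := rfl

lemma integrable_weightedSlice {d : ℕ} (g : C_c(ℝ × Torus d, ℝ)) :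
    Integrable (weightedSlice g) := by
  have h1 : Continuous (weightedSlice g) :=
    continuous_gaussianPDFReal_zero_one.smul g.toContinuousMap.curry.continuous
  refine h1.integrable_of_hasCompactSupport
    (HasCompactSupport.intro (g.hasCompactSupport.image continuous_fst) fun t ht => ?_)
  ext x
  rw [weightedSlice_apply, image_eq_zero_of_notMem_tsupport (f := g)
    fun h => ht ⟨(t, x), h, rfl⟩, mul_zero, ContinuousMap.zero_apply]

/-- The positive functional on `C_c(ℝ × 𝕋^d)` induced by `L`, with time weighted by the standard
Gaussian so that the representing measure is finite. -/
def weightedFunctional {d : ℕ} {L : Predual d → ℝ} (hL : IsProbFunctional L) :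
    C_c(ℝ × Torus d, ℝ) →ₚ[ℝ] ℝ :=
  PositiveLinearMap.mk₀
    { toFun := fun g => L ((integrable_weightedSlice g).toL1 _)
      map_add' := fun f g => by
        rw [← hL.map_add, ← Integrable.toL1_add]
        congr 2
        ext t x
        simp [weightedSlice_apply, mul_add]
      map_smul' := fun c g => by
        rw [RingHom.id_apply, smul_eq_mul, ← hL.map_smul, ← Integrable.toL1_smul]
        congr 2
        ext t x
        simp [weightedSlice_apply, mul_left_comm] }
    fun g hg => by
      refine hL.nonneg _ ?_
      filter_upwards [(integrable_weightedSlice g).coeFn_toL1] with t ht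
      rw [ht]
      exact fun x => mul_nonneg (gaussianPDFReal_nonneg 0 1 t) (hg (t, x))

lemma weightedFunctional_apply {d : ℕ} {L : Predual d → ℝ} (hL : IsProbFunctional L)
    (g : C_c(ℝ × Torus d, ℝ)) :
    weightedFunctional hL g = L ((integrable_weightedSlice g).toL1 _) := rfl

/-- The time marginal of the representing measure is the standard Gaussian. -/
lemma fst_rieszMeasure_weightedFunctional {d : ℕ} {L : Predual d → ℝ} (hL : IsProbFunctional L) :
    (RealRMK.rieszMeasure (weightedFunctional hL)).fst = gaussianReal 0 1 := by
  set μ := RealRMK.rieszMeasure (weightedFunctional hL) with hμ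
  have hfin : IsFiniteMeasureOnCompacts μ.fst := ⟨fun K hK => by
    rw [Measure.fst_apply hK.measurableSet, ← Set.prod_univ]
    exact (hK.prod isCompact_univ).measure_lt_top⟩
  refine Measure.ext_of_integral_eq_on_compactlySupported fun θ => ?_
  let g : C_c(ℝ × Torus d, ℝ) :=
    ⟨⟨fun p => θ p.1, by fun_prop⟩,
      HasCompactSupport.intro (θ.hasCompactSupport.prod isCompact_univ) fun p hp =>
        image_eq_zero_of_notMem_tsupport (f := θ) fun h => hp ⟨h, trivial⟩⟩
  have hθ : Integrable fun t => gaussianPDFReal 0 1 t * θ t :=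
    (continuous_gaussianPDFReal_zero_one.mul θ.continuous).integrable_of_hasCompactSupport
      θ.hasCompactSupport.mul_left
  calc ∫ t, θ t ∂μ.fst = ∫ p, g p ∂μ :=
        integral_map measurable_fst.aemeasurable θ.continuous.aestronglyMeasurable
    _ = L ((hθ.smul_const (1 : C(Torus d, ℝ))).toL1 _) := by
        rw [hμ, RealRMK.integral_rieszMeasure, weightedFunctional_apply]
        congr 2
        ext t x
        simp [weightedSlice_apply, g]
    _ = ∫ t, θ t ∂gaussianReal 0 1 := by
        rw [hL.map_time _ hθ, integral_gaussianReal_eq_integral_smul one_ne_zero]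
        rfl

lemma IsProbFunctional.abs_sub_le {d : ℕ} {L : Predual d → ℝ} (hL : IsProbFunctional L)
    (f g : Predual d) : |L f - L g| ≤ ‖f - g‖ := by
  have h : L f - L g = L (f - g) := by
    rw [sub_eq_add_neg f g, ← neg_one_smul ℝ g, hL.map_add, hL.map_smul]
    ring
  rw [h]
  exact hL.abs_apply_le _

/-- Two functionals agree once they agree on the weighted slices, which are dense. -/
lemma IsProbFunctional.ext_weightedSlice {d : ℕ} {L M : Predual d → ℝ} (hL : IsProbFunctional L)
    (hM : IsProbFunctional M)
    (h : ∀ g : C_c(ℝ × Torus d, ℝ), L ((integrable_weightedSlice g).toL1 _) =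
      M ((integrable_weightedSlice g).toL1 _)) : L = M := by
  funext f
  refine eq_of_abs_sub_le_all fun ε hε => ?_
  obtain ⟨k, hk, hfk, hkc, hki⟩ :=
    (L1.integrable_coeFn f).exists_hasCompactSupport_integral_sub_le (half_pos hε)
  -- dividing by the weight exhibits `k` as a weighted slice
  let g : C_c(ℝ × Torus d, ℝ) :=
    ⟨⟨fun p => (gaussianPDFReal 0 1 p.1)⁻¹ * k p.1 p.2, by
        have := continuous_gaussianPDFReal_zero_one
        refine ((this.comp continuous_fst).inv₀
          fun p => (gaussianPDFReal_pos 0 1 p.1 one_ne_zero).ne').mul ?_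
        fun_prop⟩,
      HasCompactSupport.intro (hk.prod isCompact_univ) fun p hp => by
        have : k p.1 = 0 := image_eq_zero_of_notMem_tsupport fun h => hp ⟨h, trivial⟩
        simp [this]⟩
  have hg : weightedSlice g = k := by
    ext t x
    exact mul_inv_cancel_left₀ (gaussianPDFReal_pos 0 1 t one_ne_zero).ne' _
  have hg' : (integrable_weightedSlice g).toL1 _ = hki.toL1 k := by
    congr 1
  have h1 : L (hki.toL1 k) = M (hki.toL1 k) := by
    rw [← hg']
    exact h g
  have h2 : ‖f - hki.toL1 k‖ ≤ ε / 2 := by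
    refine le_trans (le_of_eq ?_) hfk
    rw [L1.norm_eq_integral_norm]
    refine integral_congr_ae ?_
    filter_upwards [Lp.coeFn_sub f (hki.toL1 k), hki.coeFn_toL1] with t ht ht'
    rw [ht, Pi.sub_apply, ht']
  have h3 := abs_le.1 ((hL.abs_sub_le f (hki.toL1 k)).trans h2)
  have h4 := abs_le.1 ((hM.abs_sub_le f (hki.toL1 k)).trans h2)
  rw [abs_le]
  constructor <;> linarith [h3.1, h3.2, h4.1, h4.2]

/-- Every positive normalised functional on `L¹(ℝ; C(𝕋^d))` is represented by a measurable family
of probability measures: disintegrate the Riesz measure of `weightedFunctional` over time. -/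
theorem IsProbFunctional.exists_pairing_eq {d : ℕ} {L : Predual d → ℝ} (hL : IsProbFunctional L) :
    ∃ ν : LinfProb d, pairing ν.1 = L := by
  set μ := RealRMK.rieszMeasure (weightedFunctional hL) with hμ
  have hfst : μ.fst = gaussianReal 0 1 := fst_rieszMeasure_weightedFunctional hL
  have hfin : IsFiniteMeasure μ := ⟨by
    rw [← Measure.fst_univ, hfst]
    exact measure_lt_top _ _⟩
  refine ⟨⟨μ.condKernel, inferInstance⟩, ?_⟩
  refine (isProbFunctional_pairing _).ext_weightedSlice hL fun g => ?_
  rw [pairing_toL1, ← weightedFunctional_apply hL, ← RealRMK.integral_rieszMeasure, ← hμ]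
  have hg : Integrable g (μ.fst ⊗ₘ μ.condKernel) := by
    rw [μ.disintegrate]
    exact g.integrable
  conv_rhs => rw [← μ.disintegrate μ.condKernel, Measure.integral_compProd hg, hfst,
    integral_gaussianReal_eq_integral_smul one_ne_zero]
  simp_rw [weightedSlice_apply, integral_const_mul, smul_eq_mul]

/-! ### Eigenfunctions give stationary families -/

lemma continuous_pairing_const {d : ℕ} :
    Continuous fun ρ : ProbabilityMeasure (Torus d) =>
      pairing fun _ : ℝ => (ρ : Measure (Torus d)) := by
  refine continuous_pi fun f => ?_
  set F : C(Torus d, ℝ) := ∫ t, f t with hF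
  have h : ∀ ρ : ProbabilityMeasure (Torus d),
      pairing (fun _ : ℝ => (ρ : Measure (Torus d))) f = ∫ x, F x ∂(ρ : Measure (Torus d)) := by
    intro ρ
    let l : C(Torus d, ℝ) →L[ℝ] ℝ := LinearMap.mkContinuous
      { toFun := fun φ => ∫ x, φ x ∂(ρ : Measure (Torus d))
        map_add' := fun φ ψ =>
          integral_add (integrable_continuousMap _ _) (integrable_continuousMap _ _)
        map_smul' := fun c φ => integral_const_mul c _ } 1
      fun φ => by simpa using abs_integral_le_norm φ (ρ : Measure (Torus d))
    exact l.integral_comp_comm (L1.integrable_coeFn f)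
  simp_rw [h]
  exact continuous_iff_continuousAt.2 fun ρ =>
    ProbabilityMeasure.tendsto_iff_forall_integral_tendsto.1 tendsto_id
      (BoundedContinuousFunction.mkOfCompact F)

lemma density_propagator_of_isEigenfunction {d : ℕ} {H : EuclideanSpace ℝ (Fin d) → ℝ} {h : ℝ}
    {u : L2 d} (hu : IsEigenfunction H h u) (t : ℝ) :
    density (propagator H h t u) = density u := by
  obtain ⟨E, hE⟩ := hu.propagator_eq
  rw [hE, density_smul (Complex.norm_exp_ofReal_mul_I _)]

theorem constFamily_mem_limitSet {d : ℕ} {H : EuclideanSpace ℝ (Fin d) → ℝ} (τ : ℝ → ℝ)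
    {ρ : ProbabilityMeasure (Torus d)} (hρ : ρ ∈ eigenLimitSet H) :
    constFamily ρ ∈ limitSet H τ := by
  obtain ⟨u, hu, heig, hosc, hcl⟩ := hρ
  refine ⟨u, hu, hosc, ?_⟩
  obtain ⟨U, hU, hlim⟩ := mapClusterPt_iff_ultrafilter.1 hcl
  refine mapClusterPt_iff_ultrafilter.2 ⟨U, hU, ?_⟩
  refine ((continuous_pairing_const.tendsto ρ).comp hlim).congr' ?_
  filter_upwards [hU self_mem_nhdsWithin] with h hh
  simp only [density_propagator_of_isEigenfunction (heig h hh)]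
  rfl

/-! ### Averages over time windows -/

lemma integrable_window {d : ℕ} (a b : ℝ) (φ : C(Torus d, ℝ)) :
    Integrable fun t => (Set.Ioc a b).indicator (fun _ => (1 : ℝ)) t • φ :=
  ((integrable_indicator_iff measurableSet_Ioc).2
    (integrableOn_const measure_Ioc_lt_top.ne)).smul_const φ

/-- The test function `𝟏_{(a, b]}(t) φ(x)` in `L¹(ℝ; C(𝕋^d))`. -/
def window {d : ℕ} (a b : ℝ) (φ : C(Torus d, ℝ)) : Predual d :=
  (integrable_window a b φ).toL1 _

lemma pairing_window {d : ℕ} (ν : ℝ → Measure (Torus d)) {a b : ℝ} (hab : a ≤ b)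
    (φ : C(Torus d, ℝ)) : pairing ν (window a b φ) = ∫ t in a..b, ∫ x, φ x ∂ν t := by
  rw [window, pairing_toL1, intervalIntegral.integral_of_le hab,
    ← integral_indicator measurableSet_Ioc]
  congr 1
  ext t
  by_cases ht : t ∈ Set.Ioc a b <;> simp [ht]

lemma window_add {d : ℕ} (a b : ℝ) (φ ψ : C(Torus d, ℝ)) :
    window a b (φ + ψ) = window a b φ + window a b ψ := by
  rw [window, window, window, ← Integrable.toL1_add]
  congr 1
  ext t x
  simp

lemma window_smul {d : ℕ} (a b c : ℝ) (φ : C(Torus d, ℝ)) :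
    window a b (c • φ) = c • window a b φ := by
  rw [window, window, ← Integrable.toL1_smul]
  congr 1
  ext t x
  simp [mul_left_comm]

lemma norm_window_le {d : ℕ} (φ : C(Torus d, ℝ)) : ‖window 0 1 φ‖ ≤ ‖φ‖ := by
  rw [L1.norm_eq_integral_norm]
  have h : ∫ t, ‖window 0 1 φ t‖ = ∫ t, (Set.Ioc (0 : ℝ) 1).indicator (fun _ => ‖φ‖) t := by
    refine integral_congr_ae ?_
    filter_upwards [(integrable_window 0 1 φ).coeFn_toL1] with t ht
    rw [window, ht]
    by_cases ht : t ∈ Set.Ioc (0 : ℝ) 1 <;> simp [ht]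
  rw [h, integral_indicator measurableSet_Ioc]
  simp

/-- A bounded function averaged over the short windows `[s, s + ε]` has, for a suitable
`s`, almost its mean over `(a, b]`. -/
lemma exists_integral_le_window_average {G : ℝ → ℝ} (hG : Measurable G) {C : ℝ}
    (hC : ∀ t, |G t| ≤ C) {a b ε : ℝ} (hab : a < b) (hε : 0 ≤ ε) :
    ∃ s, ∫ t in a..b, G t ≤ (b - a) * (∫ r in (0 : ℝ)..1, G (s + ε * r)) + 2 * C * ε := by
  have hC0 : 0 ≤ C := (abs_nonneg _).trans (hC 0)
  have hint : ∀ x y, IntervalIntegrable G volume x y := fun x y =>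
    (intervalIntegrable_const (c := C)).mono_fun hG.aestronglyMeasurable
      (ae_of_all _ fun t => (hC t).trans (le_abs_self C))
  have hJint : Integrable (Function.uncurry fun s r => G (s + ε * r))
      ((volume.restrict (Set.Ioc a b)).prod (volume.restrict (Set.Ioc (0 : ℝ) 1))) :=
    (integrable_const C).mono' (hG.comp (by fun_prop)).aestronglyMeasurable
      (ae_of_all _ fun p => hC _)
  have hswap : ∫ s in a..b, ∫ r in (0 : ℝ)..1, G (s + ε * r) =
      ∫ r in (0 : ℝ)..1, ∫ s in a..b, G (s + ε * r) := by
    simp_rw [intervalIntegral.integral_of_le hab.le, intervalIntegral.integral_of_le zero_le_one]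
    exact integral_integral_swap hJint
  have hbd : ∀ x y, x ≤ y → |∫ t in x..y, G t| ≤ C * (y - x) := fun x y hxy => by
    have := intervalIntegral.norm_integral_le_of_norm_le_const (a := x) (b := y) (f := G)
      (C := C) fun t _ => hC t
    rwa [abs_of_nonneg (sub_nonneg.2 hxy)] at this
  -- translating the interval by `ε r ≤ ε` changes the integral by at most `2 C ε`
  have hshift : ∀ r ∈ Set.Icc (0 : ℝ) 1,
      (∫ t in a..b, G t) - 2 * C * ε ≤ ∫ s in a..b, G (s + ε * r) := by
    intro r hr
    rw [intervalIntegral.integral_comp_add_right]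
    have h1 := intervalIntegral.integral_add_adjacent_intervals (hint a (a + ε * r))
      (hint (a + ε * r) (b + ε * r))
    have h2 := intervalIntegral.integral_add_adjacent_intervals (hint a b)
      (hint b (b + ε * r))
    have hεr : 0 ≤ ε * r := mul_nonneg hε hr.1
    have hεr' : C * (ε * r) ≤ C * ε :=
      mul_le_mul_of_nonneg_left (mul_le_of_le_one_right hε hr.2) hC0
    have h3 := abs_le.1 (hbd a (a + ε * r) (by linarith))
    have h4 := abs_le.1 (hbd b (b + ε * r) (by linarith))
    rw [add_sub_cancel_left] at h3 h4
    linarith [h3.1, h3.2, h4.1, h4.2]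
  have hlow : (∫ t in a..b, G t) - 2 * C * ε ≤
      ∫ s in a..b, ∫ r in (0 : ℝ)..1, G (s + ε * r) := by
    rw [hswap]
    have hint' : IntervalIntegrable (fun r => ∫ s in a..b, G (s + ε * r)) volume 0 1 := by
      have := hJint.integral_prod_right
      rw [intervalIntegrable_iff_integrableOn_Ioc_of_le zero_le_one]
      simp only [intervalIntegral.integral_of_le hab.le]
      exact this
    have := intervalIntegral.integral_mono_on zero_le_one
      (intervalIntegrable_const (c := (∫ t in a..b, G t) - 2 * C * ε)) hint' hshift
    simpa using this
  have hJ : IntegrableOn (fun s => ∫ r in (0 : ℝ)..1, G (s + ε * r)) (Set.Ioc a b) := by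
    have := hJint.integral_prod_left
    simp only [intervalIntegral.integral_of_le zero_le_one]
    exact this
  obtain ⟨s, -, hs⟩ := exists_setAverage_le (by simp [hab]) (by simp) hJ
  refine ⟨s, ?_⟩
  rw [setAverage_eq, ← intervalIntegral.integral_of_le hab.le, smul_eq_mul,
    Real.volume_real_Ioc_of_le hab.le, inv_mul_le_iff₀ (sub_pos.2 hab)] at hs
  linarith

/-! ### Passing to a shorter time scale -/

/-- By weak-* compactness, evolved densities converge along every ultrafilter, and the limit is
an element of `ℳ(τ)`. -/
lemma exists_tendsto_mem_limitSet {d : ℕ} (H : EuclideanSpace ℝ (Fin d) → ℝ) (τ : ℝ → ℝ)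
    {U : Ultrafilter ℝ} (hU : (U : Filter ℝ) ≤ 𝓝[>] 0) {v : ℝ → L2 d} (hv : ∀ h, ‖v h‖ = 1)
    (hosc : IsOscillating v) :
    ∃ ν ∈ limitSet H τ, Tendsto
      (fun h => pairing (fun t => density (propagator H h (τ h * t) (v h)))) U
      (𝓝 (pairing ν.1)) := by
  obtain ⟨L, hL, hlim⟩ := (isCompact_setOf_isProbFunctional d).ultrafilter_le_nhds
    (U.map fun h => pairing (fun t => density (propagator H h (τ h * t) (v h))))
    (le_principal_iff.2 (Ultrafilter.mem_map.2 (Filter.univ_mem' fun h =>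
      isProbFunctional_pairing (evolvedDensity H h (τ h) (hv h)))))
  obtain ⟨ν, rfl⟩ := IsProbFunctional.exists_pairing_eq hL
  exact ⟨ν, ⟨v, hv, hosc, mapClusterPt_iff_ultrafilter.2 ⟨U, hU, hlim⟩⟩, hlim⟩

/-- The means over `(a, b]` of a limit at scale `τ` are bounded by the unit-window averages of
limits at the shorter scale `τ'`: a unit window at scale `τ'` has length `τ' / τ → 0` at scale `τ`,
and the flow up to its initial time is absorbed in the initial data. -/
lemma exists_integral_le_of_mem_limitSet {d : ℕ} {H : EuclideanSpace ℝ (Fin d) → ℝ} {τ τ' : ℝ → ℝ}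
    (hτ : ∀ h, 0 < h → 0 < τ h) (hτ' : ∀ h, 0 < h → 0 < τ' h)
    (hlt : Tendsto (fun h => τ' h / τ h) (𝓝[>] 0) (𝓝 0)) {ν : LinfProb d}
    (hν : ν ∈ limitSet H τ) (φ : C(Torus d, ℝ)) {a b : ℝ} (hab : a < b) :
    ∃ ν' ∈ limitSet H τ',
      ∫ t in a..b, ∫ x, φ x ∂ν.1 t ≤ (b - a) * pairing ν'.1 (window 0 1 φ) := by
  obtain ⟨u, hu, hosc, hcl⟩ := hν
  obtain ⟨U, hU, hlim⟩ := mapClusterPt_iff_ultrafilter.1 hcl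
  set G : ℝ → ℝ → ℝ := fun h t => ∫ x, φ x ∂density (propagator H h (τ h * t) (u h)) with hG
  have hGmeas : ∀ h, Measurable (G h) := fun h =>
    (stronglyMeasurable_integral_kernel (evolvedDensity H h (τ h) (hu h)).1
      (stronglyMeasurable_const (b := φ))).measurable
  have hGbd : ∀ h t, |G h t| ≤ ‖φ‖ := fun h t => by
    have : IsProbabilityMeasure (density (propagator H h (τ h * t) (u h))) :=
      isProbabilityMeasure_density (by rw [norm_propagator, hu])
    exact abs_integral_le_norm φ _
  have hex : ∀ h, ∃ s, 0 < h → ∫ t in a..b, G h t ≤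
      (b - a) * (∫ r in (0 : ℝ)..1, G h (s + τ' h / τ h * r)) + 2 * ‖φ‖ * (τ' h / τ h) := by
    intro h
    by_cases hh : 0 < h
    · obtain ⟨s, hs⟩ := exists_integral_le_window_average (hGmeas h) (hGbd h) hab
        (div_pos (hτ' h hh) (hτ h hh)).le
      exact ⟨s, fun _ => hs⟩
    · exact ⟨0, fun h' => absurd h' hh⟩
  choose s hs using hex
  obtain ⟨ν', hν', hlim'⟩ := exists_tendsto_mem_limitSet H τ' hU
    (v := fun h => propagator H h (τ h * s h) (u h))
    (fun h => by rw [norm_propagator, hu]) (hosc.propagator H _)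
  refine ⟨ν', hν', ?_⟩
  rw [← pairing_window _ hab.le]
  have h1 := (tendsto_pi_nhds.1 hlim) (window a b φ)
  have h2 := (tendsto_pi_nhds.1 hlim') (window 0 1 φ)
  have h3 := ((h2.const_mul (b - a)).add ((hlt.mono_left hU).const_mul (2 * ‖φ‖)))
  rw [mul_zero, add_zero] at h3
  refine le_of_tendsto_of_tendsto h1 h3 ?_
  filter_upwards [hU self_mem_nhdsWithin] with h hh
  rw [pairing_window _ hab.le, pairing_window _ zero_le_one]
  refine (hs h hh).trans (le_of_eq ?_)
  congr 3
  ext r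
  rw [hG]
  have hτ0 : τ h ≠ 0 := (hτ h hh).ne'
  have : τ h * (s h + τ' h / τ h * r) = τ' h * r + τ h * s h := by
    field_simp
    ring
  simp only [this, propagator_propagator]

/-- A bound on the unit-window averages over `ℳ(τ')` holds pointwise for elements of `ℳ(τ)`. -/
lemma ae_integral_le_of_mem_limitSet {d : ℕ} {H : EuclideanSpace ℝ (Fin d) → ℝ} {τ τ' : ℝ → ℝ}
    (hτ : ∀ h, 0 < h → 0 < τ h) (hτ' : ∀ h, 0 < h → 0 < τ' h)
    (hlt : Tendsto (fun h => τ' h / τ h) (𝓝[>] 0) (𝓝 0)) {ν : LinfProb d}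
    (hν : ν ∈ limitSet H τ) {φ : C(Torus d, ℝ)} {c : ℝ}
    (hc : ∀ ν' ∈ limitSet H τ', pairing ν'.1 (window 0 1 φ) ≤ c) :
    ∀ᵐ t, ∫ x, φ x ∂ν.1 t ≤ c := by
  have hmeas : StronglyMeasurable fun t => ∫ x, φ x ∂ν.1 t :=
    stronglyMeasurable_integral_kernel ν.1 (stronglyMeasurable_const (b := φ))
  have hint : LocallyIntegrable fun t => ∫ x, φ x ∂ν.1 t :=
    (locallyIntegrable_const ‖φ‖).mono hmeas.aestronglyMeasurable
      (ae_of_all _ fun t => (abs_integral_le_norm φ _).trans (le_abs_self _))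
  filter_upwards [LocallyIntegrable.ae_hasDerivAt_integral hint] with t ht
  have hd := (ht t).hasDerivWithinAt (s := Set.Ioi t)
  rw [hasDerivWithinAt_iff_tendsto_slope' (by simp)] at hd
  refine le_of_tendsto hd ?_
  filter_upwards [self_mem_nhdsWithin] with b hb
  have hb' : t < b := hb
  obtain ⟨ν', hν', hle⟩ := exists_integral_le_of_mem_limitSet hτ hτ' hlt hν φ hb'
  rw [slope_def_field, intervalIntegral.integral_same, sub_zero, div_le_iff₀ (sub_pos.2 hb'),
    mul_comm c]
  exact hle.trans (mul_le_mul_of_nonneg_left (hc ν' hν') (sub_pos.2 hb').le)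

/-! ### Separation -/

/-- A continuous functional on `ℝ^X` with the product topology acts on linear elements as the
evaluation at one point. -/
lemma exists_eval_of_continuousLinearMap {X : Type*} [AddCommGroup X] [Module ℝ X]
    (l : (X → ℝ) →L[ℝ] ℝ) : ∃ x : X, ∀ L : X →ₗ[ℝ] ℝ, l L = L x := by
  have h : (l : (X → ℝ) →ₗ[ℝ] ℝ) ∈
      Submodule.span ℝ (Set.range fun x : X => (LinearMap.proj x : (X → ℝ) →ₗ[ℝ] ℝ)) := by
    rw [LinearMap.mem_span_iff_continuous]
    exact l.continuous
  suffices H : ∀ m ∈ Submodule.span ℝ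
      (Set.range fun x : X => (LinearMap.proj x : (X → ℝ) →ₗ[ℝ] ℝ)),
      ∃ x : X, ∀ L : X →ₗ[ℝ] ℝ, m L = L x from H _ h
  intro m hm
  induction hm using Submodule.span_induction with
  | mem m hm =>
    obtain ⟨x, rfl⟩ := hm
    exact ⟨x, fun L => rfl⟩
  | zero => exact ⟨0, fun L => by simp⟩
  | add m n _ _ hm hn =>
    obtain ⟨x, hx⟩ := hm
    obtain ⟨y, hy⟩ := hn
    exact ⟨x + y, fun L => by rw [LinearMap.add_apply, hx, hy, map_add]⟩
  | smul c m _ hm =>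
    obtain ⟨x, hx⟩ := hm
    exact ⟨c • x, fun L => by rw [LinearMap.smul_apply, hx, map_smul]⟩

/-- The unit-window average of a functional, as a function of the spatial test function. -/
def windowAverage (d : ℕ) : (Predual d → ℝ) →L[ℝ] (C(Torus d, ℝ) → ℝ) where
  toFun L φ := L (window 0 1 φ)
  map_add' _ _ := rfl
  map_smul' _ _ := rfl
  cont := continuous_pi fun φ => continuous_apply (window 0 1 φ)

/-- If `ρ` satisfies, on a dense set of test functions, every rational upper bound common to the
unit-window averages of the elements of `A`, then `ρ` is the unit-window average of an element of
the closed convex hull of `A`. -/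
lemma exists_mem_closedConv_windowAverage_eq {d : ℕ} (A : Set (LinfProb d))
    (ρ : Measure (Torus d)) [IsProbabilityMeasure ρ] {D : Set C(Torus d, ℝ)} (hD : Dense D)
    (h : ∀ φ ∈ D, ∀ q : ℚ, (∀ ν ∈ A, pairing ν.1 (window 0 1 φ) ≤ q) → ∫ x, φ x ∂ρ ≤ q) :
    ∃ ν ∈ closedConv A, ∀ φ, pairing ν.1 (window 0 1 φ) = ∫ x, φ x ∂ρ := by
  set K : Set (Predual d → ℝ) :=
    closedConvexHull ℝ ((fun ν' : LinfProb d => pairing ν'.1) '' A) with hK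
  have hKsub : K ⊆ {L | IsProbFunctional L} :=
    closedConvexHull_min (by rintro _ ⟨ν, -, rfl⟩; exact isProbFunctional_pairing ν)
      (convex_setOf_isProbFunctional d) (isClosed_setOf_isProbFunctional d)
  have hKcomp : IsCompact K :=
    (isCompact_setOf_isProbFunctional d).of_isClosed_subset isClosed_closedConvexHull hKsub
  have hCclosed : IsClosed (windowAverage d '' K) :=
    (hKcomp.image (windowAverage d).continuous).isClosed
  have hCconv : Convex ℝ (windowAverage d '' K) :=
    convex_closedConvexHull.linear_image (windowAverage d).toLinearMap
  let R : C(Torus d, ℝ) →ₗ[ℝ] ℝ :=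
    { toFun := fun φ => ∫ x, φ x ∂ρ
      map_add' := fun φ ψ =>
        integral_add (integrable_continuousMap _ _) (integrable_continuousMap _ _)
      map_smul' := fun c φ => integral_const_mul c _ }
  have hR : ∀ φ, R φ = ∫ x, φ x ∂ρ := fun φ => rfl
  suffices hmem : (R : C(Torus d, ℝ) → ℝ) ∈ windowAverage d '' K by
    obtain ⟨L, hL, hLR⟩ := hmem
    obtain ⟨ν, rfl⟩ := IsProbFunctional.exists_pairing_eq (hKsub hL)
    exact ⟨ν, hL, fun φ => congrFun hLR φ⟩
  by_contra hnot
  obtain ⟨l, c, hlC, hlR⟩ := geometric_hahn_banach_closed_point hCconv hCclosed hnot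
  obtain ⟨φ, hφ⟩ := exists_eval_of_continuousLinearMap l
  rw [hφ R] at hlR
  -- the separating test function may be moved into `D`, because both sides are 1-Lipschitz
  obtain ⟨ψ, hψD, hψ⟩ := Metric.dense_iff.1 hD φ ((R φ - c) / 3) (by linarith)
  rw [Metric.mem_ball, dist_eq_norm] at hψD
  obtain ⟨q, hq1, hq2⟩ := exists_rat_btwn
    (show c + (R φ - c) / 3 < R φ - (R φ - c) / 3 by linarith)
  have h1 : ∫ x, ψ x ∂ρ ≤ q := by
    refine h ψ hψ q fun ν hν => ?_
    have hp := isProbFunctional_pairing ν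
    let P : C(Torus d, ℝ) →ₗ[ℝ] ℝ :=
      { toFun := fun φ => pairing ν.1 (window 0 1 φ)
        map_add' := fun φ ψ => by rw [window_add, hp.map_add]
        map_smul' := fun c φ => by rw [window_smul, hp.map_smul, RingHom.id_apply, smul_eq_mul] }
    have hPc : P φ < c := by
      rw [← hφ P]
      exact hlC _ ⟨pairing ν.1, subset_closedConvexHull ⟨ν, hν, rfl⟩, rfl⟩
    have hPd : P ψ - P φ ≤ ‖ψ - φ‖ := by
      rw [← map_sub]
      exact (le_abs_self _).trans ((hp.abs_apply_le _).trans (norm_window_le _))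
    change P ψ ≤ q
    linarith
  have h2 : R φ - R ψ ≤ ‖ψ - φ‖ := by
    rw [← map_sub, norm_sub_rev]
    exact (le_abs_self _).trans (abs_integral_le_norm _ ρ)
  rw [← hR] at h1
  linarith

lemma eq_bind_of_forall_pairing_window {d : ℕ} (ν : LinfProb d) (ρ : Measure (Torus d))
    [IsProbabilityMeasure ρ] (h : ∀ φ, pairing ν.1 (window 0 1 φ) = ∫ x, φ x ∂ρ) :
    ρ = (volume.restrict (Set.Icc (0 : ℝ) 1)).bind ν.1 := by
  have hbind : (volume.restrict (Set.Icc (0 : ℝ) 1)).bind ν.1 =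
      ((volume.restrict (Set.Icc (0 : ℝ) 1)) ⊗ₘ ν.1).snd := (Measure.snd_compProd _ _).symm
  rw [hbind]
  refine ext_of_forall_integral_eq_of_IsFiniteMeasure fun φ => ?_
  have h1 : Integrable (fun p : ℝ × Torus d => φ p.2)
      ((volume.restrict (Set.Icc (0 : ℝ) 1)) ⊗ₘ ν.1) :=
    (integrable_const ‖φ‖).mono' (φ.continuous.comp continuous_snd).aestronglyMeasurable
      (ae_of_all _ fun p => φ.norm_coe_le_norm _)
  rw [Measure.snd, integral_map measurable_snd.aemeasurable
    φ.continuous.aestronglyMeasurable, Measure.integral_compProd h1, integral_Icc_eq_integral_Ioc,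
    ← intervalIntegral.integral_of_le zero_le_one]
  exact (h φ.toContinuousMap).symm.trans (pairing_window _ zero_le_one _)

theorem limitSet_subset_LinfIn_averageSet {d : ℕ} {H : EuclideanSpace ℝ (Fin d) → ℝ}
    {τ τ' : ℝ → ℝ} (hτ : ∀ h, 0 < h → 0 < τ h) (hτ' : ∀ h, 0 < h → 0 < τ' h)
    (hlt : Tendsto (fun h => τ' h / τ h) (𝓝[>] 0) (𝓝 0)) :
    limitSet H τ ⊆ LinfIn (averageSet H τ') := by
  intro ν hν
  obtain ⟨D, hDc, hD⟩ := TopologicalSpace.exists_countable_dense C(Torus d, ℝ)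
  have hae : ∀ᵐ t, ∀ φ ∈ D, ∀ q : ℚ,
      (∀ ν' ∈ limitSet H τ', pairing ν'.1 (window 0 1 φ) ≤ q) → ∫ x, φ x ∂ν.1 t ≤ q := by
    refine (ae_ball_iff hDc).2 fun φ _ => ae_all_iff.2 fun q => ?_
    by_cases hc : ∀ ν' ∈ limitSet H τ', pairing ν'.1 (window 0 1 φ) ≤ q
    · filter_upwards [ae_integral_le_of_mem_limitSet hτ hτ' hlt hν hc] with t ht _ using ht
    · exact ae_of_all _ fun t h => absurd h hc
  filter_upwards [hae] with t ht
  obtain ⟨ν', hν', heq⟩ := exists_mem_closedConv_windowAverage_eq _ (ν.1 t) hD ht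
  exact ⟨ν', hν', eq_bind_of_forall_pairing_window ν' (ν.1 t) heq⟩

end TorusSemiclassical

end

theorem mainTheorem9 (d : ℕ) (H : EuclideanSpace ℝ (Fin d) → ℝ) (hH : ContDiff ℝ ∞ H)
    (τ τ' : ℝ → ℝ) (hτ : TorusSemiclassical.IsTimeScaleToInfty τ)
    (hτ' : TorusSemiclassical.IsTimeScaleToInfty τ')
    (hlt : Tendsto (fun h => τ' h / τ h) (𝓝[>] 0) (𝓝 0)) :
    TorusSemiclassical.constFamily '' TorusSemiclassical.eigenLimitSet H ⊆
        TorusSemiclassical.limitSet H τ ∧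
      TorusSemiclassical.limitSet H τ ⊆
        TorusSemiclassical.LinfIn (TorusSemiclassical.averageSet H τ') := by
  refine ⟨?_, TorusSemiclassical.limitSet_subset_LinfIn_averageSet hτ.1 hτ'.1 hlt⟩
  rintro _ ⟨ρ, hρ, rfl⟩
  exact TorusSemiclassical.constFamily_mem_limitSet τ hρ
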